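/- Let $N\ge 3$ be an integer, $0<p<1$, $0<q\le 1$, $0\le r\le 1$, and put $h=(1-p)q$. Consider the $N$-interactions model: a random weighted graph that starts at time $n=0$ as an $N$-clique (complete graph on $N$ vertices), where this clique and all its sub-cliques have weight $1$. At each step $N$ vertices interact: all missing edges among them are drawn, the $N$-clique on them and all its sub-cliques have their weights increased by $1$, and a newly created clique thus gets weight $1$ (so the existing cliques are those contained in the initial clique or in a set of vertices that has interacted). Given the past, the interacting vertices are chosen as follows. - With probability $p$ a new vertex is added, and it interacts with $N-1$ old vertices. With probability $r$ these are the vertices of an existing $(N-1)$-clique chosen with probability proportional to its weight; with probability $1-r$ they are a uniformly chosen $(N-1)$-element set of old vertices. - With probability $1-p$ no vertex is added, and $N$ old vertices interact. With probability $q$ these are the vertices of an existing $N$-clique chosen with probability proportional to its weight; with probability $1-q$ they are a uniformly chosen $N$-element set of old vertices. Let $K(n,w)$ be the number of $N$-cliques of weight $w$, and $K_n$ the number of all $N$-cliques, after $n$ steps. Then there are positive numbers $t_1,t_2,\dots$ such that for every $w=1,2,\dots$ $$\frac{K(n,w)}{K_n}\to t_w\quad\text{almost surely as } n\to\infty .$$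 They satisfy $$t_1=\frac1{h+1},\qquad t_w=\frac{h(w-1)}{hw+1}\,t_{w-1}\quad (w>1),$$ they form a probability distribution, $\sum_{w=1}^\infty t_w=1$, and $$\lim_{w\to\infty}\frac{t_w}{\frac1h\,\Gamma\!\left(1+\frac1h\right)w^{-(1+1/h)}}=1 .$$ In particular, for $N=3$ this describes the weights of the triangles in the three-interactions model. -/

import Mathlib

open MeasureTheory Filter Topology
open scoped ENNReal

namespace NInteractions

/-- The convex combination `p • μ + (1 - p) • ν` of two discrete probability laws: with
probability `p` draw from `μ`, with probability `1 - p` draw from `ν`. -/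
noncomputable def mix {α : Type*} (p : unitInterval) (μ ν : PMF α) : PMF α :=
  ⟨fun x => ENNReal.ofReal p * μ x + ENNReal.ofReal (1 - p) * ν x, by
    have h : ∑' x, (ENNReal.ofReal p * μ x + ENNReal.ofReal (1 - p) * ν x) = 1 := by
      rw [ENNReal.tsum_add, ENNReal.tsum_mul_left, ENNReal.tsum_mul_left, μ.tsum_coe, ν.tsum_coe,
        mul_one, mul_one, ← ENNReal.ofReal_add p.2.1 (sub_nonneg.2 p.2.2)]
      simp
    exact h ▸ ENNReal.summable.hasSum⟩

/-- Draw an element `C` of the finite family `A` with probability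
`f C / ∑ D ∈ A, f D`. If the total weight is zero, which never happens in a state that the model
can reach, the value is a dummy. -/
noncomputable def weightedChoice (A : Finset (Finset ℕ)) (f : Finset ℕ → ℕ) : PMF (Finset ℕ) :=
  if h : ∑ C ∈ A, f C = 0 then PMF.pure ∅
  else
    PMF.normalize (fun C => if C ∈ A then (f C : ℝ≥0∞) else 0)
      (by
        rw [tsum_eq_sum (s := A) (fun C hC => if_neg hC), Finset.sum_congr rfl
          (fun C hC => if_pos hC)]
        exact_mod_cast h)
      (by
        rw [tsum_eq_sum (s := A) (fun C hC => if_neg hC), Finset.sum_congr rfl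
          (fun C hC => if_pos hC)]
        exact_mod_cast ENNReal.natCast_ne_top (∑ C ∈ A, f C))

/-- Draw an element of the finite family `A`, all elements having the same chance. -/
noncomputable def uniformChoice (A : Finset (Finset ℕ)) : PMF (Finset ℕ) :=
  weightedChoice A fun _ => 1

/-- A state of the evolving weighted graph. The vertices are `0, …, numVertices - 1`. A clique is
given by its set of vertices, and `weight C` is its weight; the cliques of the model are the sets of
positive weight, that is, those created by the initial clique or by an interaction (the vertices
are the `1`-cliques and the edges are the `2`-cliques). -/
@[ext]
structure State where
  numVertices : ℕ
  weight : Finset ℕ →₀ ℕ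

instance : MeasurableSpace State := ⊤

namespace State

/-- The existing cliques with `m` vertices. -/
def cliques (s : State) (m : ℕ) : Finset (Finset ℕ) :=
  s.weight.support.filter fun C => C.card = m

/-- The number of all existing `m`-cliques. -/
def numCliques (s : State) (m : ℕ) : ℕ := (s.cliques m).card

/-- The number of existing `m`-cliques of weight `w`. -/
def numCliquesOfWeight (s : State) (m w : ℕ) : ℕ :=
  ((s.cliques m).filter fun C => s.weight C = w).card

/-- The interaction of the vertices in `T`: the clique on `T` and all its sub-cliques have their
weight increased by `1`, so that a newly created clique gets weight `1`. -/
noncomputable def interact (s : State) (T : Finset ℕ) : State where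
  numVertices := s.numVertices
  weight := s.weight + ∑ C ∈ T.powerset.erase ∅, Finsupp.single C 1

/-- A new vertex is added, and it interacts with the old vertices in `T`. -/
noncomputable def interactNew (s : State) (T : Finset ℕ) : State :=
  State.interact ⟨s.numVertices + 1, s.weight⟩ (insert s.numVertices T)

/-- All `m`-element sets of existing vertices. -/
def vertexSets (s : State) (m : ℕ) : Finset (Finset ℕ) :=
  (Finset.range s.numVertices).powersetCard m

end State

/-- The initial state: an `N`-clique, which has weight `1` as all its sub-cliques. -/
noncomputable def initialState (N : ℕ) : State := State.interact ⟨N, 0⟩ (Finset.range N)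

/-- The law of the next state. With probability `p` a new vertex interacts with `N - 1` old
vertices; these are, with probability `r`, those of an `(N - 1)`-clique chosen with probability
proportional to its weight and, with probability `1 - r`, chosen uniformly. With probability
`1 - p`, `N` old vertices interact; these are, with probability `q`, those of an `N`-clique chosen
with probability proportional to its weight and, with probability `1 - q`, chosen uniformly. -/
noncomputable def step (N : ℕ) (p q r : unitInterval) (s : State) : PMF State :=
  mix p
    ((mix r (weightedChoice (s.cliques (N - 1)) s.weight)
      (uniformChoice (s.vertexSets (N - 1)))).map s.interactNew)
    ((mix q (weightedChoice (s.cliques N) s.weight)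
      (uniformChoice (s.vertexSets N))).map s.interact)

/-- `S 0, S 1, …` is an evolution of the `N`-interactions model on the probability space `(Ω, μ)`:
the Markov chain started from the initial `N`-clique whose transition probabilities are given
by `step`. -/
structure IsEvolution (N : ℕ) (p q r : unitInterval) {Ω : Type*} [MeasurableSpace Ω]
    (μ : Measure Ω) (S : ℕ → Ω → State) : Prop where
  measurable : ∀ n, Measurable (S n)
  initial : ∀ᵐ ω ∂μ, S 0 ω = initialState N
  markov : ∀ (n : ℕ) (x : ℕ → State) (y : State),
    μ {ω | (∀ i ≤ n, S i ω = x i) ∧ S (n + 1) ω = y} =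
      μ {ω | ∀ i ≤ n, S i ω = x i} * step N p q r (x n) y

section Existence

open ProbabilityTheory Preorder

instance : Countable State :=
  Function.Injective.countable (f := fun s : State => (s.numVertices, s.weight))
    (fun s t h => by cases s; cases t; simp_all)

instance : DiscreteMeasurableSpace State := ⟨fun _ => trivial⟩

/-- The transition kernel of the model, as a function of the whole past. -/
noncomputable def ker (N : ℕ) (p q r : unitInterval) (n : ℕ) :
    Kernel (Π i : Finset.Iic n, (fun _ : ℕ => State) i) State :=
  (Kernel.ofFunOfCountable fun s => (step N p q r s).toMeasure).comap
    (fun x => x ⟨n, by simp⟩) (measurable_pi_apply _)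

instance (N p q r n) : IsMarkovKernel (ker N p q r n) := by
  constructor; intro a; simp only [ker, Kernel.comap_apply, Kernel.ofFunOfCountable]
  exact PMF.toMeasure.isProbabilityMeasure _

/-- The model exists for all values of the parameters. -/
theorem exists_isEvolution (N : ℕ) (p q r : unitInterval) :
    ∃ μ : Measure (ℕ → State), IsProbabilityMeasure μ ∧
      IsEvolution N p q r μ (fun n ω => ω n) := by
  let μ := Kernel.traj (X := fun _ => State) (ker N p q r) 0 (fun _ => initialState N)
  refine ⟨μ, inferInstance, fun n => measurable_pi_apply n, ?_, ?_⟩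
  · have h1 : μ.map (frestrictLe (π := fun _ => State) 0) = Measure.dirac (fun _ => initialState N) := by
      simp only [μ]
      rw [Kernel.traj_map_frestrictLe_apply, Kernel.partialTraj_self, Kernel.id_apply]
    have h2 : ∀ᵐ s ∂(μ.map (frestrictLe (π := fun _ => State) 0)), s ⟨0, by simp⟩ = initialState N := by
      rw [h1, ae_dirac_iff]
      exact measurable_pi_apply (X := fun _ : Finset.Iic 0 => State) _ (measurableSet_singleton _)
    exact ae_of_ae_map (by fun_prop) h2
  · intro n x y
    have h := Kernel.partialTraj_compProd_eq_map_traj (X := fun _ => State) (κ := ker N p q r)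
      (a := 0) (b := n) (Nat.zero_le n) (x₀ := fun _ => initialState N)
    rw [← Kernel.traj_map_frestrictLe_apply] at h
    let A : Set (Π i : Finset.Iic n, State) := {z | ∀ i, z i = x i}
    have hA : MeasurableSet A := by
      have : A = ⋂ i : Finset.Iic n, (fun z => z i) ⁻¹' {x i} := by ext; simp [A]
      rw [this]; exact MeasurableSet.iInter fun i => measurable_pi_apply i (measurableSet_singleton _)
    have h' := congrArg (fun m => m (A ×ˢ {y})) h
    rw [Measure.compProd_apply_prod hA (measurableSet_singleton _),
      Measure.map_apply (by fun_prop) (hA.prod (measurableSet_singleton _))] at h'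
    have e1 : {ω : ℕ → State | (∀ i ≤ n, ω i = x i) ∧ ω (n + 1) = y} = (fun ω => (frestrictLe (π := fun _ => State) n ω, ω (n+1))) ⁻¹' (A ×ˢ {y}) := by
      ext; simp [A]
    have e2 : {ω : ℕ → State | (∀ i ≤ n, ω i = x i)} = (frestrictLe (π := fun _ => State) n) ⁻¹' A := by
      ext; simp [A]
    rw [e1, e2, ← Measure.map_apply (by fun_prop) hA]
    refine h'.symm.trans ?_
    rw [setLIntegral_congr_fun (g := fun _ => step N p q r (x n) y) hA, setLIntegral_const, mul_comm]
    intro z hz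
    have : z ⟨n, by simp⟩ = x n := hz _
    simp only [ker, Kernel.comap_apply, Kernel.ofFunOfCountable]
    change (step N p q r (z ⟨n, by simp⟩)).toMeasure {y} = _
    rw [this, PMF.toMeasure_apply_singleton _ _ (measurableSet_singleton _)]

end Existence

end NInteractions

/-! An interacting `N`-set contains exactly one `N`-set, itself, so each step raises the weight of
exactly one `N`-clique, old or new, by `1`. After `n` steps the total weight of the `N`-cliques is
therefore exactly `n + 1`, and a preferential choice of an old clique picks a given clique of weight
`w` with probability `w / (n + 1)`. A step with a new vertex always creates a clique of weight `1`,
however the `N - 1` old vertices are chosen; this is why `r` does not appear in the limit. A uniform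
choice of `N` old vertices almost always creates one as well: the number of vertices grows like `p *
n`, so there are at least of order `n ^ 2` sets to choose from and at most `n + 1` existing cliques.
Up to `o(1)`, the conditional mean increment of `K n` is thus `1 - h`, and that of `K(n, w)` is `(1
- h) * [w = 1] + h * ((w - 1) * K(n, w - 1) - w * K(n, w)) / (n + 1)`. The centred increments are
bounded and orthogonal, so their averages vanish almost surely (`IsEvolution.ae_tendsto_centred`).
What is left is a deterministic recursion, solved by `tendsto_div_of_recursion`. Induction on `w`
gives `K(n, w) / n → (1 - h) * t w`, while `K n / n → 1 - h > 0`; the quotient tends to `t w`.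
Solving the recursion for `t` gives a quotient of a factorial and a rising product, `limitWeight`.
Euler's limit formula for the Gamma function yields its asymptotics, and a telescoping sum its total
mass. -/

namespace NInteractions

/-! ### A deterministic recursion with linear feedback. -/

/-- A sequence with linearly bounded perturbations: if
`x (n + 1) = x n * (1 - c / (n + 1)) + g n + d n` where `g` converges and the partial sums of `d`
are `o(n)`, then `x n / n` converges. -/
theorem tendsto_div_of_recursion {x g d : ℕ → ℝ} {c γ : ℝ} (hc : 0 ≤ c)
    (hx : ∀ n, x (n + 1) = x n * (1 - c / (n + 1)) + g n + d n)
    (hg : Tendsto g atTop (𝓝 γ))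
    (hd : Tendsto (fun n : ℕ => (∑ k ∈ Finset.range n, d k) / n) atTop (𝓝 0)) :
    Tendsto (fun n : ℕ => x n / n) atTop (𝓝 (γ / (1 + c))) := by
  have hc1 : (1 + c) ≠ 0 := by positivity
  set D : ℕ → ℝ := fun n => ∑ k ∈ Finset.range n, d k with hD
  -- Subtracting the whole noise `D`, together with the expected linear growth, leaves a
  -- perturbation `ε` that tends to zero termwise: the noise survives only through `D n / (n + 1)`.
  set y : ℕ → ℝ := fun n => x n - D n - γ / (1 + c) * n with hy
  set ε : ℕ → ℝ := fun n => c * γ / (1 + c) * (1 / ((n : ℝ) + 1)) - c * (D n / (n + 1)) + (g n - γ)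
    with hε
  have hrec (n : ℕ) : y (n + 1) = y n * (1 - c / (n + 1)) + ε n := by
    have hn : (n : ℝ) + 1 ≠ 0 := by positivity
    simp only [hy, hε, hx, hD, Finset.sum_range_succ]
    push_cast
    field_simp
    ring
  have hD1 : Tendsto (fun n : ℕ => D n / ((n : ℝ) + 1)) atTop (𝓝 0) := by
    refine squeeze_zero_norm' ?_ (tendsto_zero_iff_norm_tendsto_zero.1 hd)
    filter_upwards [eventually_gt_atTop 0] with n hn
    have hn : (0 : ℝ) < n := by exact_mod_cast hn
    rw [norm_div, norm_div, Real.norm_of_nonneg hn.le,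
      Real.norm_of_nonneg (by positivity : (0 : ℝ) ≤ (n : ℝ) + 1)]
    gcongr
    linarith
  have hε0 : Tendsto ε atTop (𝓝 0) := by
    have := ((tendsto_one_div_add_atTop_nhds_zero_nat (𝕜 := ℝ)).const_mul
      (c * γ / (1 + c))).sub (hD1.const_mul c) |>.add (hg.sub_const γ)
    simpa [hε] using this
  -- From index `m` on, the factor `1 - c / (n + 1)` lies in `[0, 1]`, so `|y|` grows by at most
  -- `|ε|` per step and Cesàro averaging makes it `o(n)`.
  obtain ⟨m, hm⟩ := exists_nat_ge c
  have hle (j : ℕ) : |y (m + j)| ≤ |y m| + ∑ k ∈ Finset.range j, |ε (m + k)| := by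
    induction j with
    | zero => simp
    | succ j ih =>
      rw [Finset.sum_range_succ, ← add_assoc m j 1, hrec]
      have hpos : (0 : ℝ) < ((m + j : ℕ) : ℝ) + 1 := by positivity
      have h1 : |1 - c / (((m + j : ℕ) : ℝ) + 1)| ≤ 1 := by
        have h2 : c / (((m + j : ℕ) : ℝ) + 1) ≤ 1 := by
          rw [div_le_one hpos]
          push_cast
          have : (0 : ℝ) ≤ j := by positivity
          linarith
        have h3 : 0 ≤ c / (((m + j : ℕ) : ℝ) + 1) := by positivity
        rw [abs_le]
        constructor <;> linarith
      calc _ ≤ |y (m + j)| * |1 - c / (((m + j : ℕ) : ℝ) + 1)| + |ε (m + j)| := by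
            rw [← abs_mul]; exact abs_add_le _ _
        _ ≤ |y (m + j)| * 1 + |ε (m + j)| := by gcongr
        _ ≤ _ := by linarith
  have hces : Tendsto (fun j : ℕ => (j : ℝ)⁻¹ * |y m| +
      (j : ℝ)⁻¹ * ∑ k ∈ Finset.range j, |ε (m + k)|) atTop (𝓝 0) := by
    have h1 : Tendsto (fun k => |ε (m + k)|) atTop (𝓝 0) := by
      have := (hε0.comp (tendsto_add_atTop_nat m)).abs
      simpa [Function.comp_def, add_comm] using this
    have := ((tendsto_inv_atTop_nhds_zero_nat (𝕜 := ℝ)).mul_const |y m|).add h1.cesaro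
    simpa using this
  have hy0 : Tendsto (fun n : ℕ => y n / n) atTop (𝓝 0) := by
    rw [← tendsto_add_atTop_iff_nat m]
    refine squeeze_zero_norm' ?_ hces
    filter_upwards [eventually_gt_atTop 0] with j hj
    have hj : (0 : ℝ) < j := by exact_mod_cast hj
    rw [norm_div, Real.norm_of_nonneg (by positivity : (0 : ℝ) ≤ ((j + m : ℕ) : ℝ)),
      Real.norm_eq_abs, add_comm j m, ← mul_add, ← div_eq_inv_mul]
    have : (j : ℝ) ≤ ((m + j : ℕ) : ℝ) := by push_cast; linarith [(m.cast_nonneg : (0 : ℝ) ≤ m)]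
    calc _ ≤ |y (m + j)| / j := by gcongr
      _ ≤ _ := by gcongr; exact hle j
  have hsum := (hy0.add hd).add_const (γ / (1 + c))
  rw [zero_add, zero_add] at hsum
  refine hsum.congr' ?_
  filter_upwards [eventually_gt_atTop 0] with n hn
  have hn : (n : ℝ) ≠ 0 := by positivity
  simp only [hy]
  field_simp
  ring

/-! ### The limit distribution and its tail. -/

/-- The limiting proportion of the cliques of weight `w`. -/
noncomputable def limitWeight (h : ℝ) (w : ℕ) : ℝ :=
  1 / h * (w - 1).factorial / ∏ j ∈ Finset.range w, (1 + 1 / h + j)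

theorem limitWeight_pos {h : ℝ} (hh : 0 < h) (w : ℕ) : 0 < limitWeight h w := by
  unfold limitWeight
  have : 0 < ∏ j ∈ Finset.range w, (1 + 1 / h + (j : ℝ)) :=
    Finset.prod_pos fun j _ => by positivity
  positivity

theorem limitWeight_one {h : ℝ} (hh : 0 < h) : limitWeight h 1 = 1 / (h + 1) := by
  have : h + 1 ≠ 0 := by positivity
  simp only [limitWeight, Finset.prod_range_one]
  simp
  field_simp

theorem limitWeight_succ {h : ℝ} (hh : 0 < h) {w : ℕ} (hw : 1 ≤ w) :
    limitWeight h (w + 1) = h * w / (h * (w + 1) + 1) * limitWeight h w := by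
  have h1 : 0 < ∏ j ∈ Finset.range w, (1 + 1 / h + (j : ℝ)) :=
    Finset.prod_pos fun j _ => by positivity
  obtain ⟨v, rfl⟩ : ∃ v, w = v + 1 := ⟨w - 1, by omega⟩
  unfold limitWeight
  rw [Finset.prod_range_succ _ (v + 1)]
  have h2 : 1 + 1 / h + ((v + 1 : ℕ) : ℝ) ≠ 0 := by positivity
  have h3 : h * (((v + 1 : ℕ) : ℝ) + 1) + 1 ≠ 0 := by positivity
  simp only [Nat.add_sub_cancel, Nat.factorial_succ]
  have h4 : h * (((v + 1 : ℕ) : ℝ) + 1) + 1 = h * (1 + 1 / h + ((v + 1 : ℕ) : ℝ)) := by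
    field_simp; ring
  rw [h4]
  push_cast at h2 ⊢
  field_simp

/-- The recursion reads `t w = h * (w - 1) * t (w - 1) - h * w * t w`, so the sum telescopes. -/
theorem limitWeight_sum {h : ℝ} (hh : 0 < h) (n : ℕ) :
    ∑ w ∈ Finset.range (n + 1), limitWeight h (w + 1)
      = 1 - h * (n + 1) * limitWeight h (n + 1) := by
  induction n with
  | zero =>
    have : h + 1 ≠ 0 := by positivity
    simp [limitWeight_one hh]
    field_simp
    ring
  | succ n ih =>
    rw [Finset.sum_range_succ, ih, limitWeight_succ hh (w := n + 1) (by omega)]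
    have : h * (((n + 1 : ℕ) : ℝ) + 1) + 1 ≠ 0 := by positivity
    push_cast at this ⊢
    field_simp
    ring

/-- Links the weights to Euler's sequence for `Γ(1 + 1/h)`, which carries the whole asymptotics. -/
theorem limitWeight_succ_eq_GammaSeq {h : ℝ} (hh : 0 < h) {n : ℕ} (hn : 0 < n) :
    limitWeight h (n + 1) = 1 / h * Real.GammaSeq (1 + 1 / h) n * (n : ℝ) ^ (-(1 + 1 / h)) := by
  have : (0 : ℝ) < n := by exact_mod_cast hn
  rw [Real.rpow_neg this.le, limitWeight, Real.GammaSeq]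
  have : 0 < (n : ℝ) ^ (1 + 1 / h) := by positivity
  simp only [Nat.add_sub_cancel]
  field_simp

theorem tendsto_limitWeight_asymptotic {h : ℝ} (hh : 0 < h) :
    Tendsto (fun w : ℕ => limitWeight h w /
      (1 / h * Real.Gamma (1 + 1 / h) * (w : ℝ) ^ (-(1 + 1 / h)))) atTop (𝓝 1) := by
  rw [← tendsto_add_atTop_iff_nat 1]
  have hG : 0 < Real.Gamma (1 + 1 / h) := Real.Gamma_pos_of_pos (by positivity)
  have h1 := (Real.GammaSeq_tendsto_Gamma (1 + 1 / h)).div_const (Real.Gamma (1 + 1 / h))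
  -- Compensates for the shift: Euler's sequence at `n` describes the weight at `n + 1`.
  have h2 : Tendsto (fun n : ℕ => (((n : ℝ) / (n + 1)) ^ (-(1 + 1 / h)))) atTop (𝓝 1) := by
    have := (tendsto_natCast_div_add_atTop (1 : ℝ)).rpow_const (p := -(1 + 1 / h))
      (Or.inl one_ne_zero)
    simpa using this
  have h3 := h1.mul h2
  rw [div_self hG.ne', one_mul] at h3
  refine h3.congr' ?_
  filter_upwards [eventually_gt_atTop 0] with n hn
  rw [limitWeight_succ_eq_GammaSeq hh hn]
  have hn : (0 : ℝ) < n := by exact_mod_cast hn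
  rw [Real.div_rpow hn.le (by positivity)]
  push_cast
  have : (0 : ℝ) < ((n : ℝ) + 1) ^ (-(1 + 1 / h)) := by positivity
  field_simp

/-- The remainder `h * w * t w` of the telescoped sum has order `w ^ (-1/h)`, hence vanishes. -/
theorem hasSum_limitWeight {h : ℝ} (hh : 0 < h) :
    HasSum (fun w : ℕ => limitWeight h (w + 1)) 1 := by
  rw [hasSum_iff_tendsto_nat_of_nonneg (fun w => (limitWeight_pos hh _).le),
    ← tendsto_add_atTop_iff_nat 1]
  simp only [limitWeight_sum hh]
  have h1 : Tendsto (fun w : ℕ => (w : ℝ) ^ (-(1 / h))) atTop (𝓝 0) :=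
    (tendsto_rpow_neg_atTop (by positivity)).comp tendsto_natCast_atTop_atTop
  have h2 : Tendsto (fun w : ℕ => (w : ℝ) * limitWeight h w) atTop (𝓝 0) := by
    have := ((tendsto_limitWeight_asymptotic hh).mul h1).mul_const
      (1 / h * Real.Gamma (1 + 1 / h))
    rw [mul_zero, zero_mul] at this
    refine this.congr' ?_
    filter_upwards [eventually_gt_atTop 0] with n hn
    have hn : (0 : ℝ) < n := by exact_mod_cast hn
    have hG : 0 < Real.Gamma (1 + 1 / h) := Real.Gamma_pos_of_pos (by positivity)
    rw [show -(1 / h) = 1 + -(1 + 1 / h) by ring, Real.rpow_add hn, Real.rpow_one]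
    have : (0 : ℝ) < (n : ℝ) ^ (-(1 + 1 / h)) := by positivity
    field_simp
  have h3 := ((h2.comp (tendsto_add_atTop_nat 1)).const_mul h).const_sub 1
  simpa [Function.comp_def, mul_assoc] using h3

end NInteractions

/-! ### A strong law of large numbers for the transitions of the chain. -/

namespace NInteractions

/-- If the values along the squares are `o(k ^ 2)` and the increments are bounded, then the
sequence is `o(n)`. -/
theorem tendsto_div_of_tendsto_div_sq {u : ℕ → ℝ} {B : ℝ} (hB : ∀ n, |u (n + 1) - u n| ≤ B)
    (hu : Tendsto (fun k : ℕ => u (k ^ 2) / (k : ℝ) ^ 2) atTop (𝓝 0)) :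
    Tendsto (fun n : ℕ => u n / n) atTop (𝓝 0) := by
  have hB0 : 0 ≤ B := (abs_nonneg _).trans (hB 0)
  have hinc (m j : ℕ) : |u (m + j) - u m| ≤ B * j := by
    induction j with
    | zero => simp
    | succ j ih =>
      have := abs_sub_le (u (m + j + 1)) (u (m + j)) (u m)
      have h2 := hB (m + j)
      rw [← add_assoc]
      push_cast
      linarith
  have hsqrt : Tendsto Nat.sqrt atTop atTop :=
    tendsto_atTop_atTop.2 fun b => ⟨b ^ 2, fun a ha => Nat.le_sqrt'.2 ha⟩
  have h1 : Tendsto (fun k : ℕ => |u (k ^ 2) / (k : ℝ) ^ 2| + 2 * B * (k : ℝ)⁻¹) atTop (𝓝 0) := by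
    simpa using hu.abs.add ((tendsto_inv_atTop_nhds_zero_nat (𝕜 := ℝ)).const_mul (2 * B))
  refine squeeze_zero_norm' ?_ (h1.comp hsqrt)
  filter_upwards [eventually_gt_atTop 0] with n hn
  set k := n.sqrt with hk
  have hk1 : k ^ 2 ≤ n := Nat.sqrt_le' n
  have hk2 : n ≤ k ^ 2 + 2 * k := by
    have := Nat.sqrt_le_add n
    rw [← hk] at this
    nlinarith
  have hk0 : 0 < k := Nat.sqrt_pos.2 hn
  have hk0' : (0 : ℝ) < k := by exact_mod_cast hk0
  have hn' : (0 : ℝ) < n := by exact_mod_cast hn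
  obtain ⟨j, hj⟩ := Nat.exists_eq_add_of_le hk1
  have hj2 : (j : ℝ) ≤ 2 * k := by
    have : j ≤ 2 * k := by omega
    exact_mod_cast this
  have h3 : |u n| ≤ |u (k ^ 2)| + B * (2 * k) := by
    have := hinc (k ^ 2) j
    rw [← hj] at this
    have h4 := abs_sub_abs_le_abs_sub (u n) (u (k ^ 2))
    have : B * j ≤ B * (2 * k) := by gcongr
    linarith
  have hkn : (k : ℝ) ^ 2 ≤ n := by exact_mod_cast hk1
  simp only [Function.comp_apply, Real.norm_eq_abs]
  rw [abs_div, abs_div, abs_of_pos hn', abs_of_pos (by positivity : (0 : ℝ) < (k : ℝ) ^ 2), ← hk]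
  calc |u n| / n ≤ |u n| / (k : ℝ) ^ 2 := by gcongr
    _ ≤ (|u (k ^ 2)| + B * (2 * k)) / (k : ℝ) ^ 2 := by gcongr
    _ = _ := by field_simp

/-- Centred partial sums with linearly growing second moments satisfy the strong law along the
squares. -/
theorem ae_tendsto_div_sq_of_integral_sq_le {Ω : Type*} [MeasurableSpace Ω] {μ : Measure Ω}
    [IsFiniteMeasure μ] {D : ℕ → Ω → ℝ} {B : ℝ} (hm : ∀ n, Measurable (D n))
    (hi : ∀ n, Integrable (fun ω => D n ω ^ 2) μ) (hD : ∀ n : ℕ, ∫ ω, D n ω ^ 2 ∂μ ≤ B * n) :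
    ∀ᵐ ω ∂μ, Tendsto (fun k : ℕ => D (k ^ 2) ω / (k : ℝ) ^ 2) atTop (𝓝 0) := by
  have hle (k : ℕ) : ∫ ω, (D (k ^ 2) ω / (k : ℝ) ^ 2) ^ 2 ∂μ ≤ B * (1 / (k : ℝ) ^ 2) := by
    simp only [div_pow, integral_div]
    have h1 := hD (k ^ 2)
    rcases Nat.eq_zero_or_pos k with rfl | hk
    · simp
    · have hk : (0 : ℝ) < k := by exact_mod_cast hk
      push_cast at h1
      rw [div_le_iff₀ (by positivity)]
      refine h1.trans_eq ?_
      field_simp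
  -- Along the squares the second moments are at most `B / k ^ 2`, which is summable. So the series
  -- of squares is almost surely finite and its terms tend to zero.
  have hfin : ∑' k : ℕ, ∫⁻ ω, ENNReal.ofReal ((D (k ^ 2) ω / (k : ℝ) ^ 2) ^ 2) ∂μ ≠ ⊤ := by
    have hs : Summable fun k : ℕ => B * (1 / (k : ℝ) ^ 2) :=
      (Real.summable_one_div_nat_pow.2 one_lt_two).mul_left B
    refine ne_top_of_le_ne_top hs.tsum_ofReal_ne_top (ENNReal.tsum_le_tsum fun k => ?_)
    rw [← ofReal_integral_eq_lintegral_ofReal _ (Eventually.of_forall fun ω => sq_nonneg _)]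
    · exact ENNReal.ofReal_le_ofReal (hle k)
    · simp only [div_pow]
      exact (hi _).div_const _
  have hmeas (k : ℕ) :
      Measurable fun ω => ENNReal.ofReal ((D (k ^ 2) ω / (k : ℝ) ^ 2) ^ 2) :=
    (((hm _).div_const _).pow_const 2).ennreal_ofReal
  rw [← lintegral_tsum fun k => (hmeas k).aemeasurable] at hfin
  filter_upwards [ae_lt_top (Measurable.tsum hmeas) hfin] with ω hω
  have h1 := (ENNReal.summable_toReal hω.ne).tendsto_atTop_zero
  have h2 := h1.sqrt
  simp only [ENNReal.toReal_ofReal (sq_nonneg _), Real.sqrt_sq_eq_abs, Real.sqrt_zero] at h2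
  exact (tendsto_zero_iff_abs_tendsto_zero _).2 h2

variable {N : ℕ} {p q r : unitInterval} {Ω : Type*} [MeasurableSpace Ω] {μ : Measure Ω}
  {S : ℕ → Ω → State}

/-- The states up to time `n`. -/
def history (S : ℕ → Ω → State) (n : ℕ) (ω : Ω) : Π i : Finset.Iic n, (fun _ : ℕ => State) i :=
  fun i => S i ω

theorem IsEvolution.measurable_history (hS : IsEvolution N p q r μ S) (n : ℕ) :
    Measurable (history S n) :=
  measurable_pi_lambda _ fun i => hS.measurable i

/-- The joint law of the past and the next state. -/
theorem IsEvolution.map_history_next [IsProbabilityMeasure μ] (hS : IsEvolution N p q r μ S)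
    (n : ℕ) :
    μ.map (fun ω => (history S n ω, S (n + 1) ω))
      = (μ.map (history S n)).compProd (ker N p q r n) := by
  have hh := hS.measurable_history n
  have : IsProbabilityMeasure (μ.map (history S n)) :=
    Measure.isProbabilityMeasure_map hh.aemeasurable
  refine Measure.ext_of_singleton fun a => ?_
  obtain ⟨z, y⟩ := a
  rw [← Set.singleton_prod_singleton, Measure.compProd_apply_prod (measurableSet_singleton _)
    (measurableSet_singleton _), Measure.map_apply (hh.prodMk (hS.measurable _))
    ((measurableSet_singleton _).prod (measurableSet_singleton _)), lintegral_singleton,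
    Measure.map_apply hh (measurableSet_singleton _)]
  -- The Markov property speaks of infinite sequences; the finite history is continued by its last
  -- state.
  let x : ℕ → State := fun i => z ⟨min i n, by simp⟩
  have hxz (i : Finset.Iic n) : x i = z i :=
    congrArg (fun j => (z j : State)) (Subtype.ext (min_eq_left (Finset.mem_Iic.1 i.2)))
  have hx (ω : Ω) : history S n ω = z ↔ ∀ i ≤ n, S i ω = x i := by
    constructor
    · intro h i hi
      rw [hxz ⟨i, Finset.mem_Iic.2 hi⟩, ← h]
      rfl
    · intro h
      funext i
      rw [← hxz]
      exact h i (Finset.mem_Iic.1 i.2)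
  have hm := hS.markov n x y
  have e1 : (fun ω => (history S n ω, S (n + 1) ω)) ⁻¹' ({z} ×ˢ {y})
      = {ω | (∀ i ≤ n, S i ω = x i) ∧ S (n + 1) ω = y} := by
    ext ω; simp [← hx]
  have e2 : history S n ⁻¹' {z} = {ω | ∀ i ≤ n, S i ω = x i} := by
    ext ω; simp [← hx]
  rw [e1, e2, hm, mul_comm]
  congr 1
  simp only [ker, ProbabilityTheory.Kernel.comap_apply,
    ProbabilityTheory.Kernel.ofFunOfCountable]
  change _ = (step N p q r (z ⟨n, by simp⟩)).toMeasure {y}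
  rw [PMF.toMeasure_apply_singleton _ _ (measurableSet_singleton _),
    ← hxz]

/-- Almost surely every transition has positive probability. -/
theorem IsEvolution.ae_mem_support [IsProbabilityMeasure μ] (hS : IsEvolution N p q r μ S) :
    ∀ᵐ ω ∂μ, ∀ n, S (n + 1) ω ∈ (step N p q r (S n ω)).support := by
  rw [ae_all_iff]
  intro n
  have hh := hS.measurable_history n
  have hm : Measurable fun ω => (history S n ω, S (n + 1) ω) := hh.prodMk (hS.measurable _)
  have : IsProbabilityMeasure (μ.map (history S n)) :=
    Measure.isProbabilityMeasure_map hh.aemeasurable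
  have h : ∀ᵐ a ∂(μ.map (fun ω => (history S n ω, S (n + 1) ω))),
      a.2 ∈ (step N p q r (a.1 ⟨n, by simp⟩)).support := by
    rw [hS.map_history_next, Measure.ae_compProd_iff (Set.to_countable _).measurableSet]
    refine Eventually.of_forall fun z => ?_
    change ∀ᵐ y ∂(step N p q r (z ⟨n, by simp⟩)).toMeasure, _
    rw [ae_iff, PMF.toMeasure_apply_eq_zero_iff _ (Set.to_countable _).measurableSet,
      Set.disjoint_left]
    exact fun y hy hy' => hy' hy
  exact ae_of_ae_map hm.aemeasurable h

/-- The conditional mean of `G s s'`, where `s'` is the state that follows `s`. -/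
noncomputable def drift (N : ℕ) (p q r : unitInterval) (G : State → State → ℝ) (s : State) : ℝ :=
  ∫ y, G s y ∂(step N p q r s).toMeasure

theorem abs_drift_le {G : State → State → ℝ} {B : ℝ} (hG : ∀ s y, |G s y| ≤ B) (s : State) :
    |drift N p q r G s| ≤ B := by
  have := norm_integral_le_of_norm_le_const (μ := (step N p q r s).toMeasure)
    (f := fun y => G s y) (Eventually.of_forall fun y => hG s y)
  simpa [drift] using this

/-- Centred transitions are orthogonal to bounded functions of the past. -/
theorem IsEvolution.integral_mul_centred_eq_zero [IsProbabilityMeasure μ]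
    (hS : IsEvolution N p q r μ S) {G : State → State → ℝ} {B : ℝ} (hG : ∀ s y, |G s y| ≤ B)
    {n : ℕ} {z : (Π i : Finset.Iic n, (fun _ : ℕ => State) i) → ℝ} {A : ℝ} (hz : ∀ x, |z x| ≤ A) :
    ∫ ω, z (history S n ω) * (G (S n ω) (S (n + 1) ω) - drift N p q r G (S n ω)) ∂μ = 0 := by
  have hh := hS.measurable_history n
  have hm : Measurable fun ω => (history S n ω, S (n + 1) ω) := hh.prodMk (hS.measurable _)
  have : IsProbabilityMeasure (μ.map (history S n)) :=
    Measure.isProbabilityMeasure_map hh.aemeasurable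
  let F : (Π i : Finset.Iic n, (fun _ : ℕ => State) i) × State → ℝ := fun a =>
    z a.1 * (G (a.1 ⟨n, by simp⟩) a.2 - drift N p q r G (a.1 ⟨n, by simp⟩))
  have hF : Measurable F := measurable_of_countable F
  have hA : 0 ≤ A := (abs_nonneg _).trans (hz fun _ => initialState 0)
  have hFB (a) : ‖F a‖ ≤ A * (2 * B) := by
    simp only [F, norm_mul, Real.norm_eq_abs]
    have h1 := hG (a.1 ⟨n, by simp⟩) a.2
    have h2 := abs_drift_le (N := N) (p := p) (q := q) (r := r) hG (a.1 ⟨n, by simp⟩)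
    have h3 := abs_sub (G (a.1 ⟨n, by simp⟩) a.2) (drift N p q r G (a.1 ⟨n, by simp⟩))
    exact mul_le_mul (hz _) (by linarith) (abs_nonneg _) hA
  have h1 : ∫ ω, z (history S n ω) * (G (S n ω) (S (n + 1) ω) - drift N p q r G (S n ω)) ∂μ
      = ∫ a, F a ∂(μ.map (fun ω => (history S n ω, S (n + 1) ω))) := by
    rw [integral_map hm.aemeasurable hF.aestronglyMeasurable]
    rfl
  rw [h1, hS.map_history_next, Measure.integral_compProd
    (Integrable.of_bound hF.aestronglyMeasurable _ (Eventually.of_forall hFB))]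
  refine integral_eq_zero_of_ae (Eventually.of_forall fun x => ?_)
  change ∫ y, z x * (G (x ⟨n, by simp⟩) y - drift N p q r G (x ⟨n, by simp⟩))
    ∂(step N p q r (x ⟨n, by simp⟩)).toMeasure = 0
  rw [integral_const_mul, integral_sub _ (integrable_const _)]
  · simp [drift]
  · exact Integrable.of_bound (measurable_of_countable _).aestronglyMeasurable B
      (Eventually.of_forall fun y => hG _ y)

/-- The strong law of large numbers for bounded functions of the transitions. -/
theorem IsEvolution.ae_tendsto_centred [IsProbabilityMeasure μ] (hS : IsEvolution N p q r μ S)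
    {G : State → State → ℝ} {B : ℝ} (hG : ∀ s y, |G s y| ≤ B) :
    ∀ᵐ ω ∂μ, Tendsto (fun n : ℕ => (∑ k ∈ Finset.range n,
      (G (S k ω) (S (k + 1) ω) - drift N p q r G (S k ω))) / n) atTop (𝓝 0) := by
  let δ : State → State → ℝ := fun s y => G s y - drift N p q r G s
  have hδ (s y : State) : |δ s y| ≤ 2 * B := by
    have h3 := abs_sub (G s y) (drift N p q r G s)
    have h2 := abs_drift_le (N := N) (p := p) (q := q) (r := r) hG s
    linarith [hG s y]
  let D : ℕ → Ω → ℝ := fun n ω => ∑ k ∈ Finset.range n, δ (S k ω) (S (k + 1) ω)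
  have hδm (k : ℕ) : Measurable fun ω => δ (S k ω) (S (k + 1) ω) :=
    (measurable_of_countable (Function.uncurry δ)).comp
      ((hS.measurable k).prodMk (hS.measurable (k + 1)))
  have hDm (n : ℕ) : Measurable (D n) := Finset.measurable_sum _ fun k _ => hδm k
  have hsum (n : ℕ) (x : ℕ → State) :
      |∑ k ∈ Finset.range n, δ (x k) (x (k + 1))| ≤ 2 * B * n := by
    refine (Finset.abs_sum_le_sum_abs _ _).trans ?_
    refine (Finset.sum_le_sum fun k _ => hδ _ _).trans_eq ?_
    simp [mul_comm]
  have hB0 : 0 ≤ 2 * B := (abs_nonneg _).trans (hδ (initialState 0) (initialState 0))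
  have hbdd {f : Ω → ℝ} (hf : Measurable f) (C : ℝ) (hC : ∀ ω, |f ω| ≤ C) : Integrable f μ :=
    Integrable.of_bound hf.aestronglyMeasurable C (Eventually.of_forall hC)
  have hDi (n : ℕ) : Integrable (fun ω => D n ω ^ 2) μ := by
    refine hbdd ((hDm n).pow_const 2) ((2 * B * n) ^ 2) fun ω => ?_
    rw [abs_pow]
    exact pow_le_pow_left₀ (abs_nonneg _) (hsum n fun k => S k ω) 2
  have hDD (n : ℕ) : ∫ ω, D n ω ^ 2 ∂μ ≤ (2 * B) ^ 2 * n := by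
    induction n with
    | zero => simp [D]
    | succ n ih =>
      -- `D n` depends only on the history up to `n`. The `min` keeps the indices in range and
      -- changes nothing for `k < n`.
      have horth : ∫ ω, D n ω * δ (S n ω) (S (n + 1) ω) ∂μ = 0 := by
        have h1 := hS.integral_mul_centred_eq_zero hG (n := n)
          (z := fun x => ∑ k ∈ Finset.range n,
            δ (x ⟨min k n, by simp⟩) (x ⟨min (k + 1) n, by simp⟩)) (A := 2 * B * n)
          (fun x => hsum n fun k => x ⟨min k n, by simp⟩)
        rw [← h1]
        congr 1
        funext ω
        congr 1
        refine Finset.sum_congr rfl fun k hk => ?_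
        have hk := Finset.mem_range.1 hk
        simp [history, hk.le, Nat.succ_le_of_lt hk]
      have hi1 : Integrable (fun ω => 2 * (D n ω * δ (S n ω) (S (n + 1) ω))) μ := by
        refine hbdd (((hDm n).mul (hδm n)).const_mul 2) (2 * ((2 * B * n) * (2 * B))) fun ω => ?_
        rw [abs_mul, abs_mul, abs_two]
        have := mul_le_mul (hsum n fun k => S k ω) (hδ (S n ω) (S (n + 1) ω)) (abs_nonneg _)
          (by positivity)
        linarith
      have hi2 : Integrable (fun ω => δ (S n ω) (S (n + 1) ω) ^ 2) μ := by
        refine hbdd ((hδm n).pow_const 2) ((2 * B) ^ 2) fun ω => ?_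
        rw [abs_pow]
        exact pow_le_pow_left₀ (abs_nonneg _) (hδ _ _) 2
      have h2 : ∫ ω, δ (S n ω) (S (n + 1) ω) ^ 2 ∂μ ≤ (2 * B) ^ 2 := by
        have := integral_mono hi2 (integrable_const ((2 * B) ^ 2)) (fun ω => by
          rw [← sq_abs]
          exact pow_le_pow_left₀ (abs_nonneg _) (hδ _ _) 2)
        simpa using this
      have h3 : (fun ω => D (n + 1) ω ^ 2) = fun ω => (D n ω ^ 2 +
          2 * (D n ω * δ (S n ω) (S (n + 1) ω))) + δ (S n ω) (S (n + 1) ω) ^ 2 := by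
        funext ω
        simp only [D, Finset.sum_range_succ]
        ring
      have hi3 := (hDi n).add hi1
      simp only [Pi.add_def] at hi3
      rw [h3, integral_add hi3 hi2, integral_add (hDi n) hi1, integral_const_mul,
        horth]
      push_cast
      linarith
  filter_upwards [ae_tendsto_div_sq_of_integral_sq_le hDm hDi hDD] with ω hω
  refine tendsto_div_of_tendsto_div_sq (B := 2 * B) (fun n => ?_) hω
  simp only [Finset.sum_range_succ, add_sub_cancel_left]
  exact hδ _ _

end NInteractions

/-! ### Integrals over mixtures and weighted choices. -/

namespace NInteractions

instance : MeasurableSpace (Finset ℕ) := ⊤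

instance : DiscreteMeasurableSpace (Finset ℕ) := ⟨fun _ => trivial⟩

theorem toMeasure_mix {α : Type*} [Countable α] [MeasurableSpace α] [DiscreteMeasurableSpace α]
    (p : unitInterval) (μ ν : PMF α) :
    (mix p μ ν).toMeasure
      = ENNReal.ofReal p • μ.toMeasure + ENNReal.ofReal (1 - p) • ν.toMeasure := by
  refine Measure.ext_of_singleton fun a => ?_
  simp only [Measure.add_apply, Measure.smul_apply, smul_eq_mul,
    PMF.toMeasure_apply_singleton _ _ (measurableSet_singleton _)]
  rfl

theorem integral_mix {α : Type*} [Countable α] [MeasurableSpace α] [DiscreteMeasurableSpace α]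
    (p : unitInterval) (μ ν : PMF α) {f : α → ℝ} {B : ℝ} (hf : ∀ x, |f x| ≤ B) :
    ∫ x, f x ∂(mix p μ ν).toMeasure
      = p * ∫ x, f x ∂μ.toMeasure + (1 - p) * ∫ x, f x ∂ν.toMeasure := by
  have hi (ρ : PMF α) : Integrable f ρ.toMeasure :=
    Integrable.of_bound (measurable_of_countable f).aestronglyMeasurable B
      (Eventually.of_forall hf)
  rw [toMeasure_mix, integral_add_measure ((hi μ).smul_measure ENNReal.ofReal_ne_top)
    ((hi ν).smul_measure ENNReal.ofReal_ne_top), integral_smul_measure, integral_smul_measure,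
    ENNReal.toReal_ofReal p.2.1, ENNReal.toReal_ofReal (sub_nonneg.2 p.2.2), smul_eq_mul,
    smul_eq_mul]

theorem mem_support_of_mem_support_mix {α : Type*} {p : unitInterval} {μ ν : PMF α} {x : α}
    (hx : x ∈ (mix p μ ν).support) : x ∈ μ.support ∨ x ∈ ν.support := by
  rw [PMF.mem_support_iff] at hx
  by_contra hc
  simp only [PMF.mem_support_iff, not_or, not_not] at hc
  apply hx
  change ENNReal.ofReal p * μ x + ENNReal.ofReal (1 - p) * ν x = 0
  simp [hc.1, hc.2]

theorem weightedChoice_apply {A : Finset (Finset ℕ)} {f : Finset ℕ → ℕ}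
    (h : ∑ C ∈ A, f C ≠ 0) (C : Finset ℕ) :
    weightedChoice A f C
      = (if C ∈ A then (f C : ℝ≥0∞) else 0) * ((∑ D ∈ A, f D : ℕ) : ℝ≥0∞)⁻¹ := by
  rw [weightedChoice, dif_neg h, PMF.normalize_apply, tsum_eq_sum (s := A)
    (fun C hC => if_neg hC), Finset.sum_congr rfl (fun C hC => if_pos hC)]
  push_cast
  rfl

theorem mem_of_mem_support_weightedChoice {A : Finset (Finset ℕ)} {f : Finset ℕ → ℕ}
    (h : ∑ C ∈ A, f C ≠ 0) {C : Finset ℕ} (hC : C ∈ (weightedChoice A f).support) : C ∈ A := by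
  by_contra hc
  rw [PMF.mem_support_iff, weightedChoice_apply h, if_neg hc, zero_mul] at hC
  exact hC rfl

theorem integral_weightedChoice {A : Finset (Finset ℕ)} {f : Finset ℕ → ℕ}
    (h : ∑ C ∈ A, f C ≠ 0) {g : Finset ℕ → ℝ} {B : ℝ} (hg : ∀ C, |g C| ≤ B) :
    ∫ C, g C ∂(weightedChoice A f).toMeasure
      = (∑ C ∈ A, f C * g C) / ((∑ C ∈ A, f C : ℕ) : ℝ) := by
  rw [PMF.integral_eq_tsum _ _ (Integrable.of_bound
    (measurable_of_countable g).aestronglyMeasurable B (Eventually.of_forall hg)),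
    tsum_eq_sum (s := A), Finset.sum_div]
  · refine Finset.sum_congr rfl fun C hC => ?_
    rw [weightedChoice_apply h, if_pos hC, ENNReal.toReal_mul, ENNReal.toReal_natCast,
      ENNReal.toReal_inv, ENNReal.toReal_natCast, smul_eq_mul]
    ring
  · intro C hC
    rw [weightedChoice_apply h, if_neg hC]
    simp

theorem integral_weightedChoice_of_const {A : Finset (Finset ℕ)} {f : Finset ℕ → ℕ}
    (h : ∑ C ∈ A, f C ≠ 0) {g : Finset ℕ → ℝ} {B c : ℝ} (hg : ∀ C, |g C| ≤ B)
    (hc : ∀ C ∈ A, g C = c) : ∫ C, g C ∂(weightedChoice A f).toMeasure = c := by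
  have h' : ((∑ C ∈ A, f C : ℕ) : ℝ) ≠ 0 := by exact_mod_cast h
  rw [integral_weightedChoice h hg, Finset.sum_congr rfl fun C hC => by rw [hc C hC],
    ← Finset.sum_mul, div_eq_iff h']
  push_cast
  ring

/-! ### Clique weights under an interaction, and reachable states. -/

namespace State

theorem interact_weight (s : State) (T C : Finset ℕ) :
    (s.interact T).weight C = s.weight C + if C ≠ ∅ ∧ C ⊆ T then 1 else 0 := by
  simp only [interact, Finsupp.add_apply, Finsupp.finsetSum_apply, Finsupp.single_apply]
  rw [Finset.sum_ite_eq']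
  simp

theorem interact_weight_of_card {s : State} {T C : Finset ℕ} {m : ℕ} (hm : m ≠ 0)
    (hT : T.card = m) (hC : C.card = m) :
    (s.interact T).weight C = s.weight C + if C = T then 1 else 0 := by
  rw [interact_weight]
  congr 1
  refine if_congr ⟨fun h => Finset.eq_of_subset_of_card_le h.2 (by omega), ?_⟩ rfl rfl
  rintro rfl
  refine ⟨?_, subset_rfl⟩
  rintro rfl
  exact hm (by simpa using hT.symm)

theorem mem_cliques {s : State} {m : ℕ} {C : Finset ℕ} :
    C ∈ s.cliques m ↔ s.weight C ≠ 0 ∧ C.card = m := by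
  simp [cliques]

/-- The sum of `φ (weight C)` over the existing `m`-cliques `C`. -/
noncomputable def cliqueSum (m : ℕ) (φ : ℕ → ℝ) (s : State) : ℝ :=
  ∑ C ∈ s.cliques m, φ (s.weight C)

/-- Only `T` changes its weight among the `m`-sets. Since `φ 0 = 0`, a missing `T` can be counted as
a clique of weight `0`, so new and old cliques need no separate treatment. -/
theorem cliqueSum_interact {m : ℕ} (hm : m ≠ 0) {φ : ℕ → ℝ} (hφ : φ 0 = 0) (s : State)
    {T : Finset ℕ} (hT : T.card = m) :
    cliqueSum m φ (s.interact T)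
      = cliqueSum m φ s + (φ (s.weight T + 1) - φ (s.weight T)) := by
  have h1 : (s.interact T).cliques m = insert T (s.cliques m) := by
    ext C
    rw [Finset.mem_insert, mem_cliques, mem_cliques]
    constructor
    · rintro ⟨h, hC⟩
      rw [interact_weight_of_card hm hT hC] at h
      by_cases hCT : C = T
      · exact Or.inl hCT
      · exact Or.inr ⟨by simpa [hCT] using h, hC⟩
    · rintro (rfl | ⟨h, hC⟩)
      · exact ⟨by simp [interact_weight_of_card hm hT hT], hT⟩
      · exact ⟨by rw [interact_weight_of_card hm hT hC]; omega, hC⟩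
  have h2 : cliqueSum m φ s = ∑ C ∈ insert T (s.cliques m), φ (s.weight C) := by
    rw [Finset.sum_insert_of_eq_zero_if_notMem]
    · rfl
    · intro h
      rw [mem_cliques] at h
      have : s.weight T = 0 := by
        by_contra h0
        exact h ⟨h0, hT⟩
      rw [this, hφ]
  rw [h2, cliqueSum, h1]
  have h3 : ∀ C ∈ insert T (s.cliques m), φ ((s.interact T).weight C) = φ (s.weight C) +
      if C = T then φ (s.weight T + 1) - φ (s.weight T) else 0 := by
    intro C hC
    have hC' : C.card = m := by
      rcases Finset.mem_insert.1 hC with rfl | hC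
      · exact hT
      · exact (mem_cliques.1 hC).2
    rw [interact_weight_of_card hm hT hC']
    split_ifs with h
    · rw [h]; ring
    · simp
  rw [Finset.sum_congr rfl h3, Finset.sum_add_distrib, Finset.sum_ite_eq',
    if_pos (Finset.mem_insert_self _ _)]

theorem cliqueSum_weightIndicator (s : State) (m w : ℕ) :
    cliqueSum m (fun k => if k = w then 1 else 0) s = s.numCliquesOfWeight m w := by
  simp [cliqueSum, numCliquesOfWeight]

theorem cliqueSum_positiveIndicator (s : State) (m : ℕ) :
    cliqueSum m (fun k => if k = 0 then 0 else 1) s = s.numCliques m := by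
  rw [cliqueSum, numCliques, Finset.sum_congr rfl fun C hC => if_neg (mem_cliques.1 hC).1]
  simp

/-- Facts about the states that the model can reach in `n` steps. -/
structure Admissible (N n : ℕ) (s : State) : Prop where
  le_numVertices : N ≤ s.numVertices
  cliques_nonempty : (s.cliques (N - 1)).Nonempty
  subset_range : ∀ C, s.weight C ≠ 0 → C ⊆ Finset.range s.numVertices
  sum_weight : ∑ C ∈ s.cliques N, s.weight C = n + 1

/-- `y` arises from `s` by an interaction of `N` vertices, at most one of them new. -/
def Transition (N : ℕ) (s y : State) : Prop :=
  (∃ T ∈ s.vertexSets (N - 1), y = s.interactNew T) ∨ ∃ T ∈ s.vertexSets N, y = s.interact T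

variable {N n : ℕ} {s y : State}

theorem mem_vertexSets {m : ℕ} {T : Finset ℕ} :
    T ∈ s.vertexSets m ↔ T ⊆ Finset.range s.numVertices ∧ T.card = m := by
  simp [vertexSets, Finset.mem_powersetCard]

theorem Admissible.cliques_subset (hs : s.Admissible N n) (m : ℕ) :
    s.cliques m ⊆ s.vertexSets m := fun C hC =>
  mem_vertexSets.2 ⟨hs.subset_range C (mem_cliques.1 hC).1, (mem_cliques.1 hC).2⟩

theorem Admissible.sum_weight_pred_ne_zero (hs : s.Admissible N n) :
    ∑ C ∈ s.cliques (N - 1), s.weight C ≠ 0 := by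
  obtain ⟨C, hC⟩ := hs.cliques_nonempty
  intro h
  exact (mem_cliques.1 hC).1 (Finset.sum_eq_zero_iff.1 h C hC)

theorem Admissible.card_vertexSets_ne_zero (hs : s.Admissible N n) {m : ℕ} (hm : m ≤ N) :
    ∑ _C ∈ s.vertexSets m, 1 ≠ 0 := by
  have := Nat.choose_pos (hm.trans hs.le_numVertices)
  simp only [Finset.sum_const, vertexSets, Finset.card_powersetCard, Finset.card_range]
  simpa using this.ne'

theorem card_insert_numVertices {T : Finset ℕ} (hN : N ≠ 0) (hT : T ∈ s.vertexSets (N - 1)) :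
    (insert s.numVertices T).card = N := by
  obtain ⟨h1, h2⟩ := mem_vertexSets.1 hT
  rw [Finset.card_insert_of_notMem, h2]
  · omega
  · exact fun h => by simpa using h1 h

theorem Admissible.weight_insert_numVertices (hs : s.Admissible N n) (T : Finset ℕ) :
    s.weight (insert s.numVertices T) = 0 := by
  by_contra h
  simpa using hs.subset_range _ h (Finset.mem_insert_self _ _)

/-- A set containing the new vertex cannot have had positive weight before, so the contribution does
not depend on `T`. -/
theorem Admissible.cliqueSum_interactNew (hs : s.Admissible N n) (hN : N ≠ 0) {φ : ℕ → ℝ}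
    (hφ : φ 0 = 0) {T : Finset ℕ} (hT : T ∈ s.vertexSets (N - 1)) :
    cliqueSum N φ (s.interactNew T) = cliqueSum N φ s + φ 1 := by
  rw [interactNew, cliqueSum_interact hN hφ _ (card_insert_numVertices hN hT)]
  change cliqueSum N φ s + (φ (s.weight (insert s.numVertices T) + 1)
    - φ (s.weight (insert s.numVertices T))) = _
  rw [hs.weight_insert_numVertices, hφ, zero_add, sub_zero]

theorem cast_sum_weight (m : ℕ) (s : State) :
    ((∑ C ∈ s.cliques m, s.weight C : ℕ) : ℝ) = cliqueSum m (fun k => (k : ℝ)) s := by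
  rw [cliqueSum]; push_cast; rfl

theorem cliques_subset_interact (s : State) (T : Finset ℕ) (m : ℕ) :
    s.cliques m ⊆ (s.interact T).cliques m := fun C hC => by
  rw [mem_cliques] at hC ⊢
  rw [interact_weight]
  exact ⟨by omega, hC.2⟩

theorem subset_range_interact {s : State} {T : Finset ℕ}
    (hs : ∀ C, s.weight C ≠ 0 → C ⊆ Finset.range s.numVertices)
    (hT : T ⊆ Finset.range s.numVertices) (C : Finset ℕ) (hC : (s.interact T).weight C ≠ 0) :
    C ⊆ Finset.range (s.interact T).numVertices := by
  rw [interact_weight] at hC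
  by_cases h : s.weight C = 0
  · rw [h, zero_add] at hC
    exact (not_imp_comm.1 (fun h' => if_neg h') hC).2.trans hT
  · exact hs C h

theorem Admissible.transition (hs : s.Admissible N n) (hN : N ≠ 0) (hy : Transition N s y) :
    y.Admissible N (n + 1) := by
  have htot {z : State} (hz : cliqueSum N (fun k => (k : ℝ)) z
      = cliqueSum N (fun k => (k : ℝ)) s + 1) :
      ∑ C ∈ z.cliques N, z.weight C = n + 1 + 1 := by
    rw [← cast_sum_weight, ← cast_sum_weight, hs.sum_weight] at hz
    exact_mod_cast hz
  rcases hy with ⟨T, hT, rfl⟩ | ⟨T, hT, rfl⟩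
  · have hr : Finset.range s.numVertices ⊆ Finset.range (s.numVertices + 1) :=
      Finset.range_subset_range.2 (Nat.le_succ _)
    refine ⟨hs.le_numVertices.trans (Nat.le_succ _), ?_, ?_, htot ?_⟩
    · exact hs.cliques_nonempty.mono
        (cliques_subset_interact ⟨s.numVertices + 1, s.weight⟩ _ (N - 1))
    · refine subset_range_interact (s := ⟨s.numVertices + 1, s.weight⟩)
        (fun C hC => (hs.subset_range C hC).trans hr) ?_
      exact Finset.insert_subset (by simp) ((mem_vertexSets.1 hT).1.trans hr)
    · rw [hs.cliqueSum_interactNew hN (by simp) hT]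
      simp
  · refine ⟨hs.le_numVertices, hs.cliques_nonempty.mono (cliques_subset_interact _ _ _),
      subset_range_interact hs.subset_range (mem_vertexSets.1 hT).1, htot ?_⟩
    rw [cliqueSum_interact hN (by simp) _ (mem_vertexSets.1 hT).2]
    push_cast
    ring

theorem admissible_initialState (hN : 2 ≤ N) : (initialState N).Admissible N 0 := by
  refine ⟨le_rfl, ⟨Finset.range (N - 1), ?_⟩, ?_, ?_⟩
  · rw [mem_cliques, initialState, interact_weight, if_pos]
    · simp
    · refine ⟨?_, Finset.range_subset_range.2 (Nat.sub_le _ _)⟩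
      rw [Ne, Finset.range_eq_empty_iff]
      omega
  · exact subset_range_interact (s := ⟨N, 0⟩) (by simp) subset_rfl
  · have h := cliqueSum_interact (m := N) (by omega) (φ := fun k => (k : ℝ)) (by simp) ⟨N, 0⟩
      (Finset.card_range N)
    rw [← cast_sum_weight, ← cast_sum_weight] at h
    have h0 : State.cliques ⟨N, 0⟩ N = ∅ := by simp [cliques]
    simp only [h0, Finset.sum_empty] at h
    simp at h
    simp only [initialState]
    exact_mod_cast h

theorem Admissible.transition_of_mem_support {p q r : unitInterval} (hs : s.Admissible N n)
    (hy : y ∈ (step N p q r s).support) : Transition N s y := by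
  have hu {m : ℕ} (hm : m ≤ N) : ∀ T ∈ (uniformChoice (s.vertexSets m)).support,
      T ∈ s.vertexSets m := fun T hT =>
    mem_of_mem_support_weightedChoice (hs.card_vertexSets_ne_zero hm) hT
  rcases mem_support_of_mem_support_mix hy with h | h
  · obtain ⟨T, hT, rfl⟩ := (PMF.mem_support_map_iff _ _ _).1 h
    refine Or.inl ⟨T, ?_, rfl⟩
    rcases mem_support_of_mem_support_mix hT with h | h
    · exact hs.cliques_subset _ (mem_of_mem_support_weightedChoice hs.sum_weight_pred_ne_zero h)
    · exact hu (Nat.sub_le _ _) T h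
  · obtain ⟨T, hT, rfl⟩ := (PMF.mem_support_map_iff _ _ _).1 h
    refine Or.inr ⟨T, ?_, rfl⟩
    rcases mem_support_of_mem_support_mix hT with h | h
    · exact hs.cliques_subset _
        (mem_of_mem_support_weightedChoice (by rw [hs.sum_weight]; omega) h)
    · exact hu le_rfl T h

end State

/-! ### One-step drifts. -/

open State

/-- The increment of `g` in a transition, truncated to `[-B, B]`. -/
noncomputable def clippedIncrement (B : ℝ) (g : State → ℝ) (s y : State) : ℝ :=
  max (-B) (min B (g y - g s))

theorem abs_clippedIncrement_le {B : ℝ} (hB : 0 ≤ B) (g : State → ℝ) (s y : State) :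
    |clippedIncrement B g s y| ≤ B :=
  abs_le.2 ⟨le_max_left _ _, max_le (by linarith) (min_le_left _ _)⟩

/-- The strong law asks for a bound over all pairs of states, whereas increments are controlled only
along transitions from reachable states. There the truncation has no effect. -/
theorem clippedIncrement_eq {B : ℝ} {g : State → ℝ} {s y : State} (h : |g y - g s| ≤ B) :
    clippedIncrement B g s y = g y - g s := by
  rw [clippedIncrement, min_eq_right (abs_le.1 h).2, max_eq_right (abs_le.1 h).1]

variable {N n : ℕ} {p q r : unitInterval} {s y : State}

theorem drift_eq {G : State → State → ℝ} {B : ℝ} (hG : ∀ s y, |G s y| ≤ B) (s : State) :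
    drift N p q r G s =
      p * (r * ∫ T, G s (s.interactNew T) ∂(weightedChoice (s.cliques (N - 1)) s.weight).toMeasure +
        (1 - r) * ∫ T, G s (s.interactNew T) ∂(uniformChoice (s.vertexSets (N - 1))).toMeasure) +
      (1 - p) * (q * ∫ T, G s (s.interact T) ∂(weightedChoice (s.cliques N) s.weight).toMeasure +
        (1 - q) * ∫ T, G s (s.interact T) ∂(uniformChoice (s.vertexSets N)).toMeasure) := by
  have hm (f : Finset ℕ → State) : Measurable f := measurable_of_countable f
  rw [drift, step, integral_mix _ _ _ (hG s), ← PMF.toMeasure_map _ _ (hm _),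
    ← PMF.toMeasure_map _ _ (hm _), integral_map (hm _).aemeasurable
    (measurable_of_countable _).aestronglyMeasurable, integral_map (hm _).aemeasurable
    (measurable_of_countable _).aestronglyMeasurable, integral_mix _ _ _ (fun _ => hG s _),
    integral_mix _ _ _ (fun _ => hG s _)]

theorem drift_numVertices (s : State) :
    drift N p q r (clippedIncrement 1 fun y => (y.numVertices : ℝ)) s = p := by
  have hG := abs_clippedIncrement_le zero_le_one fun y : State => (y.numVertices : ℝ)
  have h1 (T) : clippedIncrement 1 (fun y : State => (y.numVertices : ℝ)) s (s.interactNew T)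
      = 1 := by
    rw [clippedIncrement_eq] <;> simp [interactNew, interact]
  have h0 (T) : clippedIncrement 1 (fun y : State => (y.numVertices : ℝ)) s (s.interact T)
      = 0 := by
    rw [clippedIncrement_eq] <;> simp [interact]
  rw [drift_eq hG]
  simp only [h1, h0]
  simp

theorem State.Admissible.abs_cliqueSum_sub_le (hs : s.Admissible N n) (hN : N ≠ 0) {φ : ℕ → ℝ}
    {B : ℝ} (hφ : φ 0 = 0) (hB : ∀ k, |φ (k + 1) - φ k| ≤ B) (hy : Transition N s y) :
    |cliqueSum N φ y - cliqueSum N φ s| ≤ B := by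
  rcases hy with ⟨T, hT, rfl⟩ | ⟨T, hT, rfl⟩
  · rw [hs.cliqueSum_interactNew hN hφ hT, add_sub_cancel_left]
    simpa [hφ] using hB 0
  · rw [cliqueSum_interact hN hφ _ (mem_vertexSets.1 hT).2, add_sub_cancel_left]
    exact hB _

/-- The drift of a clique sum, up to the effect of a uniform choice hitting an existing clique. -/
theorem State.Admissible.abs_drift_cliqueSum_sub_le (hs : s.Admissible N n) (hN : N ≠ 0)
    {φ : ℕ → ℝ} {B : ℝ} (hφ : φ 0 = 0) (hB : ∀ k, |φ (k + 1) - φ k| ≤ B) :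
    |drift N p q r (clippedIncrement B (cliqueSum N φ)) s -
      ((1 - (1 - p) * q) * φ 1 + (1 - p) * q *
        (cliqueSum N (fun k => k * (φ (k + 1) - φ k)) s / (n + 1)))|
      ≤ 2 * B * (s.numCliques N / (s.numVertices.choose N : ℝ)) := by
  have hB0 : 0 ≤ B := (abs_nonneg _).trans (hB 0)
  have hG := abs_clippedIncrement_le hB0 (cliqueSum N φ)
  have hnew (T) (hT : T ∈ s.vertexSets (N - 1)) :
      clippedIncrement B (cliqueSum N φ) s (s.interactNew T) = φ 1 := by
    rw [clippedIncrement_eq (hs.abs_cliqueSum_sub_le hN hφ hB (Or.inl ⟨T, hT, rfl⟩)),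
      hs.cliqueSum_interactNew hN hφ hT, add_sub_cancel_left]
  have hold (T) (hT : T ∈ s.vertexSets N) :
      clippedIncrement B (cliqueSum N φ) s (s.interact T)
        = φ (s.weight T + 1) - φ (s.weight T) := by
    rw [clippedIncrement_eq (hs.abs_cliqueSum_sub_le hN hφ hB (Or.inr ⟨T, hT, rfl⟩)),
      cliqueSum_interact hN hφ _ (mem_vertexSets.1 hT).2, add_sub_cancel_left]
  have hA3 : ∫ T, clippedIncrement B (cliqueSum N φ) s (s.interact T)
      ∂(weightedChoice (s.cliques N) s.weight).toMeasure
      = cliqueSum N (fun k => k * (φ (k + 1) - φ k)) s / (n + 1) := by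
    rw [integral_weightedChoice (by rw [hs.sum_weight]; omega) (fun _ => hG s _), hs.sum_weight,
      Finset.sum_congr rfl fun C hC => by rw [hold C (hs.cliques_subset N hC)], cliqueSum]
    push_cast
    rfl
  have hcard : ∑ _C ∈ s.vertexSets N, 1 = s.numVertices.choose N := by
    simp [vertexSets]
  have hne := hs.card_vertexSets_ne_zero (le_refl N)
  have hc0 : (0 : ℝ) < s.numVertices.choose N := by
    exact_mod_cast Nat.choose_pos hs.le_numVertices
  -- A uniform choice that misses the existing cliques contributes exactly `φ 1`. Each existing
  -- clique deviates from this by at most `2 * B`.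
  have hA4 : |∫ T, clippedIncrement B (cliqueSum N φ) s (s.interact T)
      ∂(uniformChoice (s.vertexSets N)).toMeasure - φ 1|
      ≤ 2 * B * (s.numCliques N / (s.numVertices.choose N : ℝ)) := by
    have h1 : ∫ T, clippedIncrement B (cliqueSum N φ) s (s.interact T)
        ∂(uniformChoice (s.vertexSets N)).toMeasure - φ 1 = (∑ T ∈ s.vertexSets N,
          (φ (s.weight T + 1) - φ (s.weight T) - φ 1)) / (s.numVertices.choose N : ℝ) := by
      rw [uniformChoice, integral_weightedChoice hne (fun _ => hG s _), hcard,
        Finset.sum_congr rfl fun C hC => by rw [hold C hC], Finset.sum_sub_distrib _ (fun _ => φ 1),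
        sub_div]
      congr 1
      · simp
      · rw [eq_div_iff hc0.ne', Finset.sum_const, nsmul_eq_mul, ← hcard]
        simp [mul_comm]
    rw [h1, abs_div, abs_of_pos hc0, mul_div_assoc']
    gcongr
    refine (Finset.abs_sum_le_sum_abs _ _).trans ?_
    rw [← Finset.sum_subset (hs.cliques_subset N)]
    · have h2 : ∀ C ∈ s.cliques N, |φ (s.weight C + 1) - φ (s.weight C) - φ 1| ≤ 2 * B := by
        intro C _
        have h3 := abs_sub (φ (s.weight C + 1) - φ (s.weight C)) (φ 1)
        have h4 := hB 0
        rw [hφ, sub_zero] at h4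
        linarith [hB (s.weight C)]
      refine (Finset.sum_le_sum h2).trans_eq ?_
      rw [Finset.sum_const, nsmul_eq_mul, mul_comm]
      rfl
    · intro T hT hT'
      have : s.weight T = 0 := by
        by_contra h0
        exact hT' (mem_cliques.2 ⟨h0, (mem_vertexSets.1 hT).2⟩)
      simp [this, hφ]
  rw [drift_eq hG, integral_weightedChoice_of_const hs.sum_weight_pred_ne_zero (fun _ => hG s _)
      (fun T hT => hnew T (hs.cliques_subset _ hT)), uniformChoice,
    integral_weightedChoice_of_const (hs.card_vertexSets_ne_zero (Nat.sub_le _ _))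
      (fun _ => hG s _) hnew, hA3]
  set I := ∫ T, clippedIncrement B (cliqueSum N φ) s (s.interact T)
      ∂(uniformChoice (s.vertexSets N)).toMeasure
  set J := cliqueSum N (fun k => k * (φ (k + 1) - φ k)) s / (n + 1)
  have hc1 : 0 ≤ (1 - (p : ℝ)) * (1 - q) := mul_nonneg (sub_nonneg.2 p.2.2) (sub_nonneg.2 q.2.2)
  have hc2 : (1 - (p : ℝ)) * (1 - q) ≤ 1 :=
    mul_le_one₀ (by linarith [p.2.1]) (sub_nonneg.2 q.2.2) (by linarith [q.2.1])
  -- With `I` replaced by `φ 1`, the coefficient of `φ 1` is `p + (1 - p) * (1 - q) = 1 - (1 - p) *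
  -- q`.
  have e : p * (r * φ 1 + (1 - r) * φ 1) + (1 - p) * (q * J + (1 - q) * I)
      - ((1 - (1 - p) * q) * φ 1 + (1 - p) * q * J) = (1 - (p : ℝ)) * (1 - q) * (I - φ 1) := by
    ring
  rw [e, abs_mul, abs_of_nonneg hc1]
  exact (mul_le_of_le_one_left (abs_nonneg _) hc2).trans hA4

end NInteractions

/-! ### Almost sure limits along the evolution. -/

namespace NInteractions

open State

variable {N : ℕ} {p q r : unitInterval} {Ω : Type*} [MeasurableSpace Ω] {μ : Measure Ω}
  {S : ℕ → Ω → State}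

theorem IsEvolution.ae_admissible [IsProbabilityMeasure μ] (hS : IsEvolution N p q r μ S)
    (hN : 2 ≤ N) :
    ∀ᵐ ω ∂μ, ∀ n, (S n ω).Admissible N n ∧ Transition N (S n ω) (S (n + 1) ω) := by
  filter_upwards [hS.initial, hS.ae_mem_support] with ω h0 hsup
  have h (n : ℕ) : (S n ω).Admissible N n := by
    induction n with
    | zero => rw [h0]; exact admissible_initialState hN
    | succ n ih => exact ih.transition (by omega) (ih.transition_of_mem_support (hsup n))
  exact fun n => ⟨h n, (h n).transition_of_mem_support (hsup n)⟩

theorem IsEvolution.ae_tendsto_numVertices_div [IsProbabilityMeasure μ]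
    (hS : IsEvolution N p q r μ S) (hN : 2 ≤ N) :
    ∀ᵐ ω ∂μ, Tendsto (fun n : ℕ => ((S n ω).numVertices : ℝ) / n) atTop (𝓝 p) := by
  filter_upwards [hS.ae_admissible hN, hS.ae_tendsto_centred
    (abs_clippedIncrement_le zero_le_one fun y : State => (y.numVertices : ℝ))] with ω hω hd
  have h := tendsto_div_of_recursion (x := fun n => ((S n ω).numVertices : ℝ)) (c := 0)
    (g := fun n => drift N p q r (clippedIncrement 1 fun y => (y.numVertices : ℝ)) (S n ω))
    (γ := p) le_rfl ?_ (by simp only [drift_numVertices]; exact tendsto_const_nhds) hd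
  · simpa using h
  · intro n
    have hle : |((S (n + 1) ω).numVertices : ℝ) - (S n ω).numVertices| ≤ 1 := by
      rcases (hω n).2 with ⟨T, -, hT⟩ | ⟨T, -, hT⟩ <;> simp [hT, interactNew, interact]
    rw [clippedIncrement_eq (g := fun y : State => (y.numVertices : ℝ)) hle]
    ring

theorem State.Admissible.numCliques_le {n : ℕ} {s : State} (hs : s.Admissible N n) :
    s.numCliques N ≤ n + 1 := by
  rw [← hs.sum_weight, numCliques, Finset.card_eq_sum_ones]
  exact Finset.sum_le_sum fun C hC => Nat.one_le_iff_ne_zero.2 (mem_cliques.1 hC).1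

/-- If the number of vertices grows linearly, linearly many sets are negligible among all
`N`-sets of vertices. -/
theorem tendsto_div_choose_of_linear {V K : ℕ → ℕ} {v : ℝ} (hN : 2 ≤ N) (hv : 0 < v)
    (hV : Tendsto (fun n : ℕ => (V n : ℝ) / n) atTop (𝓝 v)) (hK : ∀ n, K n ≤ n + 1) :
    Tendsto (fun n => (K n : ℝ) / ((V n).choose N : ℝ)) atTop (𝓝 0) := by
  have hinv := tendsto_inv_atTop_nhds_zero_nat (𝕜 := ℝ)
  have h1 : Tendsto (fun n : ℕ => (V n : ℝ) / n - N * (n : ℝ)⁻¹) atTop (𝓝 v) := by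
    simpa using hV.sub (hinv.const_mul (N : ℝ))
  have h2 : Tendsto (fun n : ℕ => (N.factorial : ℝ) * ((1 + (n : ℝ)⁻¹) * (n : ℝ)⁻¹) /
      ((V n : ℝ) / n - N * (n : ℝ)⁻¹) ^ 2) atTop (𝓝 0) := by
    simpa [Pi.div_def] using ((((hinv.const_add 1).mul hinv).const_mul (N.factorial : ℝ)).div
      (h1.pow 2) (by positivity))
  have hlarge : Tendsto (fun n : ℕ => (n : ℝ) * ((V n : ℝ) / n - N * (n : ℝ)⁻¹)) atTop atTop :=
    tendsto_natCast_atTop_atTop.atTop_mul_pos hv h1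
  refine squeeze_zero' (Eventually.of_forall fun n => by positivity) ?_ h2
  filter_upwards [eventually_gt_atTop 0, hlarge.eventually_ge_atTop 1] with n hn hn1
  have hn' : (0 : ℝ) < n := by exact_mod_cast hn
  have e : (n : ℝ) * ((V n : ℝ) / n - N * (n : ℝ)⁻¹) = V n - N := by field_simp
  rw [e] at hn1
  have hVN : N ≤ V n := by
    have : (N : ℝ) ≤ V n := by linarith
    exact_mod_cast this
  -- A quadratic lower bound already beats the linear `K`; it needs `N ≥ 2` and `V n - N ≥ 1`.
  have h3 : ((V n : ℝ) - N) ^ 2 / N.factorial ≤ ((V n).choose N : ℝ) := by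
    refine le_trans ?_ (Nat.pow_le_choose (α := ℝ) N (V n))
    gcongr
    rw [Nat.cast_sub (by omega)]
    push_cast
    calc ((V n : ℝ) - N) ^ 2 ≤ ((V n : ℝ) - N) ^ N := pow_le_pow_right₀ hn1 hN
      _ ≤ _ := by gcongr; linarith
  have h4 : (K n : ℝ) ≤ n + 1 := by exact_mod_cast hK n
  have h5 : (0 : ℝ) < (V n : ℝ) - N := by linarith
  calc (K n : ℝ) / ((V n).choose N : ℝ)
      ≤ (n + 1) / (((V n : ℝ) - N) ^ 2 / N.factorial) := by gcongr
    _ = _ := by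
      rw [← e]
      have : (V n : ℝ) / n - N * (n : ℝ)⁻¹ ≠ 0 := by
        intro h0
        rw [h0, mul_zero] at e
        linarith
      field_simp

/-- The law of large numbers for a clique sum whose drift is asymptotically
`γ - c * x / (n + 1)`. -/
theorem IsEvolution.ae_tendsto_cliqueSum_div [IsProbabilityMeasure μ]
    (hS : IsEvolution N p q r μ S) (hN : 2 ≤ N) (hp : 0 < p) {φ : ℕ → ℝ} {B c γ : ℝ}
    (hφ : φ 0 = 0) (hB : ∀ k, |φ (k + 1) - φ k| ≤ B) (hc : 0 ≤ c)
    (hγ : ∀ᵐ ω ∂μ, Tendsto (fun n : ℕ => (1 - (1 - p) * q) * φ 1 + (1 - p) * q *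
      (cliqueSum N (fun k => k * (φ (k + 1) - φ k)) (S n ω) / (n + 1)) +
      c * (cliqueSum N φ (S n ω) / (n + 1))) atTop (𝓝 γ)) :
    ∀ᵐ ω ∂μ, Tendsto (fun n : ℕ => cliqueSum N φ (S n ω) / n) atTop (𝓝 (γ / (1 + c))) := by
  have hB0 : 0 ≤ B := (abs_nonneg _).trans (hB 0)
  filter_upwards [hS.ae_admissible hN, hS.ae_tendsto_centred
    (abs_clippedIncrement_le hB0 (cliqueSum N φ)), hγ, hS.ae_tendsto_numVertices_div hN]
    with ω hω hd hγ hV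
  have hK := (tendsto_div_choose_of_linear hN (by exact_mod_cast hp) hV
    fun n => (hω n).1.numCliques_le).const_mul (2 * B)
  rw [mul_zero] at hK
  have herr := squeeze_zero_norm (fun n => (Real.norm_eq_abs _).trans_le
    ((hω n).1.abs_drift_cliqueSum_sub_le (p := p) (q := q) (r := r) (by omega) hφ hB)) hK
  -- The feedback `c * x / (n + 1)` is added to the drift, so that `g` converges to `γ`, and taken
  -- off again through the factor `1 - c / (n + 1)`.
  refine tendsto_div_of_recursion (x := fun n => cliqueSum N φ (S n ω)) hc
    (g := fun n => drift N p q r (clippedIncrement B (cliqueSum N φ)) (S n ω) +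
      c * (cliqueSum N φ (S n ω) / (n + 1))) ?_ ?_ hd
  · intro n
    rw [clippedIncrement_eq ((hω n).1.abs_cliqueSum_sub_le (by omega) hφ hB (hω n).2)]
    ring
  · have := herr.add hγ
    rw [zero_add] at this
    refine this.congr fun n => ?_
    ring

theorem IsEvolution.ae_tendsto_numCliques_div [IsProbabilityMeasure μ]
    (hS : IsEvolution N p q r μ S) (hN : 2 ≤ N) (hp : 0 < p) :
    ∀ᵐ ω ∂μ, Tendsto (fun n : ℕ => ((S n ω).numCliques N : ℝ) / n) atTop
      (𝓝 (1 - (1 - p) * q)) := by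
  have h := hS.ae_tendsto_cliqueSum_div hN hp (φ := fun k => if k = 0 then 0 else 1) (B := 1)
    (c := 0) (γ := 1 - (1 - p) * q) (by simp) (fun k => by split_ifs <;> simp) le_rfl
    (Eventually.of_forall fun ω => by
      -- For the indicator of positive weight the increment vanishes unless `k = 0`, where the
      -- factor `k` kills it: a preferential choice creates no clique.
      have h0 (n : ℕ) : cliqueSum N (fun k => (k : ℝ) *
          ((if k + 1 = 0 then 0 else 1) - (if k = 0 then 0 else 1))) (S n ω) = 0 := by
        refine Finset.sum_eq_zero fun C _ => ?_
        beta_reduce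
        split_ifs with h1 h2 <;> simp_all
      simp only [h0]
      simp)
  simpa only [cliqueSum_positiveIndicator, add_zero, div_one] using h

/-- Induction on `w`. Cliques of weight `w + 1` gain from those of weight `w` and lose to those of
weight `w + 2`; the loss is the feedback with `c = h * (w + 1)`, and the gain converges by the
induction hypothesis. -/
theorem IsEvolution.ae_tendsto_numCliquesOfWeight_div [IsProbabilityMeasure μ]
    (hS : IsEvolution N p q r μ S) (hN : 2 ≤ N) (hp : 0 < p) {h : ℝ} (hh : 0 < h)
    (heq : h = (1 - p) * q) {w : ℕ} (hw : 1 ≤ w) :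
    ∀ᵐ ω ∂μ, Tendsto (fun n : ℕ => ((S n ω).numCliquesOfWeight N w : ℝ) / n) atTop
      (𝓝 ((1 - h) * limitWeight h w)) := by
  have hsum (s : State) (w : ℕ) :
      cliqueSum N (fun k => (k : ℝ) * ((if k + 1 = w + 1 then 1 else 0) -
        (if k = w + 1 then 1 else 0))) s
      = w * s.numCliquesOfWeight N w - (w + 1) * s.numCliquesOfWeight N (w + 1) := by
    rw [← cliqueSum_weightIndicator, ← cliqueSum_weightIndicator, cliqueSum, cliqueSum, cliqueSum,
      Finset.mul_sum, Finset.mul_sum, ← Finset.sum_sub_distrib]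
    refine Finset.sum_congr rfl fun C _ => ?_
    simp only [Nat.add_right_cancel_iff]
    split_ifs with h1 h2 h2
    · omega
    · simp [h1]
    · simp [h2]
    · simp
  have key (w : ℕ) (β : ℝ) (hβ : ∀ᵐ ω ∂μ, Tendsto
      (fun n : ℕ => (w : ℝ) * (((S n ω).numCliquesOfWeight N w : ℝ) / n)) atTop (𝓝 β)) :
      ∀ᵐ ω ∂μ, Tendsto (fun n : ℕ => ((S n ω).numCliquesOfWeight N (w + 1) : ℝ) / n) atTop
        (𝓝 (((1 - h) * (if 1 = w + 1 then 1 else 0) + h * β) / (1 + h * (w + 1)))) := by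
    have := hS.ae_tendsto_cliqueSum_div hN hp (φ := fun k => if k = w + 1 then 1 else 0) (B := 1)
      (c := h * (w + 1)) (γ := (1 - h) * (if 1 = w + 1 then 1 else 0) + h * β) (by simp)
      (fun k => by split_ifs <;> simp) (by positivity) ?_
    · simpa only [cliqueSum_weightIndicator] using this
    · filter_upwards [hβ] with ω hω
      have h1 := (((hω.mul (tendsto_natCast_div_add_atTop (1 : ℝ))).const_mul h).const_add
        ((1 - h) * (if 1 = w + 1 then 1 else 0)))
      rw [mul_one] at h1
      refine h1.congr' ?_
      filter_upwards [eventually_gt_atTop 0] with n hn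
      have hn : (0 : ℝ) < n := by exact_mod_cast hn
      rw [hsum, cliqueSum_weightIndicator, ← heq]
      field_simp
      ring
  induction w, hw using Nat.le_induction with
  | base =>
    -- For weight `1` the inflow from lower weights is zero because of the factor `w = 0`; the
    -- source is the creation of cliques, of rate `1 - h`.
    have := key 0 0 (Eventually.of_forall fun ω => by simp)
    convert this using 3
    rw [limitWeight_one hh]
    simp
    field_simp
    ring
  | succ w hw ih =>
    have := key w (w * ((1 - h) * limitWeight h w)) (ih.mono fun ω hω => hω.const_mul _)
    have e : ((1 - h) * (if 1 = w + 1 then 1 else 0) + h * (w * ((1 - h) * limitWeight h w))) /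
        (1 + h * (w + 1)) = (1 - h) * limitWeight h (w + 1) := by
      rw [limitWeight_succ hh hw, if_neg (by omega)]
      field_simp
      ring
    rwa [e] at this

end NInteractions

open NInteractions

theorem mainTheorem2 (N : ℕ) (hN : 3 ≤ N) (p q r : unitInterval)
    (hp0 : 0 < p) (hp1 : p < 1) (hq : 0 < q)
    (h : ℝ) (hh : h = (1 - (p : ℝ)) * (q : ℝ)) :
    ∃ t : ℕ → ℝ,
      (∀ w, 1 ≤ w → 0 < t w) ∧
      t 1 = 1 / (h + 1) ∧
      (∀ w, 1 < w → t w = h * ((w : ℝ) - 1) / (h * (w : ℝ) + 1) * t (w - 1)) ∧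
      HasSum (fun w : ℕ => t (w + 1)) 1 ∧
      Tendsto
        (fun w : ℕ => t w / (1 / h * Real.Gamma (1 + 1 / h) * (w : ℝ) ^ (-(1 + 1 / h))))
        atTop (𝓝 1) ∧
      ∀ {Ω : Type*} [MeasurableSpace Ω] (μ : Measure Ω) [IsProbabilityMeasure μ]
        (S : ℕ → Ω → NInteractions.State), NInteractions.IsEvolution N p q r μ S →
        ∀ w, 1 ≤ w → ∀ᵐ ω ∂μ,
          Tendsto
            (fun n => ((S n ω).numCliquesOfWeight N w : ℝ) / ((S n ω).numCliques N : ℝ))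
            atTop (𝓝 (t w)) := by
  have hp0' : (0 : ℝ) < p := by exact_mod_cast hp0
  have hp1' : (p : ℝ) < 1 := by exact_mod_cast hp1
  have hq' : (0 : ℝ) < q := by exact_mod_cast hq
  have hpos : 0 < h := hh ▸ mul_pos (sub_pos.2 hp1') hq'
  -- Makes the limit `1 - h` of `K n / n` nonzero, so the two limits can be divided.
  have hlt : h < 1 := by nlinarith [q.2.2]
  refine ⟨limitWeight h, fun w _ => limitWeight_pos hpos w, limitWeight_one hpos, fun w hw => ?_,
    hasSum_limitWeight hpos, tendsto_limitWeight_asymptotic hpos, ?_⟩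
  · obtain ⟨v, rfl⟩ : ∃ v, w = v + 1 := ⟨w - 1, by omega⟩
    rw [limitWeight_succ hpos (by omega)]
    push_cast
    simp
  · intro Ω _ μ _ S hS w hw
    filter_upwards [hS.ae_tendsto_numCliques_div (by omega) hp0,
      hS.ae_tendsto_numCliquesOfWeight_div (by omega) hp0 hpos hh hw] with ω hK hKw
    rw [← hh] at hK
    have hne : 1 - h ≠ 0 := (sub_pos.2 hlt).ne'
    have := hKw.div hK hne
    rw [mul_div_cancel_left₀ _ hne] at this
    refine this.congr' ?_
    filter_upwards [eventually_gt_atTop 0] with n hn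
    have hn : (n : ℝ) ≠ 0 := by positivity
    simp only [Pi.div_apply]
    rw [div_div_div_cancel_right₀ hn]
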